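/- Let $\theta\in\{0,1,\nu\}$ and $R_\theta=\mathbb Z_4+\nu\mathbb Z_4$ with $\nu^2=\theta$. Put $k_\theta=\nu$ if $\theta\in\{0,\nu\}$ and $k_\theta=1+\nu$ if $\theta=1$. Let $\alpha_\theta\in\{1+\nu,\,1+2\nu,\,1+3\nu\}$ if $\theta=0$, $\alpha_\theta\in\{2+\nu,\,3+2\nu,\,3\nu\}$ if $\theta=1$, and $\alpha_\theta=1+2\nu$ if $\theta=\nu$. Let $n\ge 1$, and let $C$ be an $\alpha_\theta$-constacyclic code of length $n$ over $R_\theta$, i.e. an $R_\theta$-submodule of $R_\theta^n$ that is mapped onto itself by $(s_0,\dots,s_{n-1})\mapsto(\alpha_\theta s_{n-1},s_0,\dots,s_{n-2})$. Words of length $n$ are identified with polynomials of degree less than $n$, and $C$ with an ideal of $R_\theta[z]/\langle z^n-\alpha_\theta\rangle$. Let $\mathrm{Res}(C)$ be the set of $a$ over $\mathbb Z_4$ such that $a+k_\theta b\in C$ for some $b$ over $\mathbb Z_4$, and $\mathrm{Tor}(C)$ the set of $a$ over $\mathbb Z_4$ such that $k_\theta a\in C$. For a code $D$ over $\mathbb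 Z_4$ let $\mathrm{Res}(D)$ be the set of binary $a$ such that $a+2b\in D$ for some binary $b$, and $\mathrm{Tor}(D)$ the set of binary $a$ such that $2a\in D$. Put $C_1=\mathrm{Res}(\mathrm{Res}(C))$, $C_2=\mathrm{Tor}(\mathrm{Res}(C))$, $C_3=\mathrm{Res}(\mathrm{Tor}(C))$, $C_4=\mathrm{Tor}(\mathrm{Tor}(C))$; here, and whenever a binary polynomial is used over $\mathbb Z_4$ or $R_\theta$, its coefficients $0,1$ are read in that ring. When a binary polynomial is used as an element of $R_\theta[z]/\langle z^n-\alpha_\theta\rangle$, it is first reduced modulo $z^n-1$ over $\mathbb Z_2$. Then there are binary polynomials $t_{ij}\in\mathbb Z_2[z]$, $1\le i\le j\le 4$, such that: (a) $C$ is the ideal of $R_\theta[z]/\langle z^n-\alpha_\theta\rangle$ generated by $$t_{\theta_1}=t_{11}+2t_{12}+k_\theta t_{13}+2k_\theta t_{14},\quad t_{\theta_2}=2t_{22}+k_\theta t_{23}+2k_\theta t_{24},\quad t_{\theta_3}=k_\theta t_{33}+2k_\theta t_{34},\quad t_{\theta_4}=2k_\theta t_{44};$$ (b) for $1\le i\le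 4$, $t_{ii}$ is the nonzero polynomial of minimal degree whose class in $\mathbb Z_2[z]/\langle z^n-1\rangle$ generates $C_i$ (so $t_{ii}=z^n-1$ if $C_i=0$); (c) for $1\le i<j\le 4$, $t_{ij}=0$ or $\deg t_{ij}<\deg t_{jj}$. The polynomials $t_{ij}$, and hence the generators $t_{\theta_1},\dots,t_{\theta_4}$, are uniquely determined by (a), (b), (c). Moreover they satisfy: (d) $t_{22}\mid t_{11}\mid z^n-1$ and $t_{44}\mid t_{33}\mid z^n-1$ in $\mathbb Z_2[z]$; (e) either $t_{12}=0$, or $\deg t_{12}<\deg t_{22}$ and $2t_{22}$ divides $\frac{z^n-1}{t_{11}}\,(t_{11}+2t_{12})-(z^n-1)$ in $\mathbb Z_4[z]$; (f) either $t_{34}=0$, or $\deg t_{34}<\deg t_{44}$ and $2t_{44}$ divides $\frac{z^n-1}{t_{33}}\,(t_{33}+2t_{34})-(z^n-\varepsilon)$ in $\mathbb Z_4[z]$, where $\varepsilon\in\{1,-1\}\subset\mathbb Z_4$ is given by $k_\theta\alpha_\theta=\varepsilon k_\theta$. In (e) and (f) the quotients $\frac{z^n-1}{t_{ii}}$ are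 formed in $\mathbb Z_2[z]$. -/

import Mathlib

open Polynomial

namespace Constacyclic

/-- The three admissible values `0`, `1`, `ν` of `θ = ν ^ 2`. -/
inductive Theta : Type
  | zero
  | one
  | nu

/-- `ν ^ 2 = coeffA θ + coeffB θ * ν`. -/
def coeffA : Theta → ZMod 4
  | .zero => 0
  | .one => 1
  | .nu => 0

def coeffB : Theta → ZMod 4
  | .zero => 0
  | .one => 0
  | .nu => 1

/-- The ring `R_θ = Z₄ + ν Z₄` with `ν ^ 2 = θ`. -/
abbrev R (θ : Theta) : Type := QuadraticAlgebra (ZMod 4) (coeffA θ) (coeffB θ)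

/-- The element `ν` of `R_θ`. -/
def nu (θ : Theta) : R θ := ⟨0, 1⟩

theorem nu_sq_zero : nu .zero ^ 2 = 0 := by decide

theorem nu_sq_one : nu .one ^ 2 = 1 := by decide

theorem nu_sq_nu : nu .nu ^ 2 = nu .nu := by decide

/-- The element `k_θ`: it is `ν` for `θ = 0, ν` and `1 + ν` for `θ = 1`. -/
def k : (θ : Theta) → R θ
  | .zero => nu .zero
  | .one => 1 + nu .one
  | .nu => nu .nu

/-- The units of `R_θ` denoted by `α_θ`. -/
def IsAlpha : (θ : Theta) → R θ → Prop
  | .zero, u => u = 1 + nu .zero ∨ u = 1 + 2 * nu .zero ∨ u = 1 + 3 * nu .zero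
  | .one, u => u = 2 + nu .one ∨ u = 3 + 2 * nu .one ∨ u = 3 * nu .one
  | .nu, u => u = 1 + 2 * nu .nu

/-- The scalar `ε` in `Z₄` by which `u` acts on `k_θ R_θ = k_θ Z₄`, see `k_mul`. -/
def epsilon : (θ : Theta) → R θ → ZMod 4
  | .zero, u => u.re
  | .one, u => u.re + u.im
  | .nu, u => u.re + u.im

theorem k_mul (θ : Theta) (u : R θ) :
    k θ * u = algebraMap (ZMod 4) (R θ) (epsilon θ u) * k θ := by
  obtain ⟨x, y⟩ := u
  cases θ <;> revert x y <;> decide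

section Words

variable {S : Type*} [CommRing S] {n : ℕ} [NeZero n]

/-- The constacyclic shift `(s₀, …, sₙ₋₁) ↦ (u sₙ₋₁, s₀, …, sₙ₋₂)`; the subtraction in `Fin n` is
cyclic. -/
def shift (u : S) (s : Fin n → S) : Fin n → S :=
  fun i => if i = 0 then u * s (i - 1) else s (i - 1)

/-- A linear code of length `n` over `S` is `u`-constacyclic if its image under the `u`-constacyclic
shift is the code itself. -/
def IsConstacyclic (u : S) (D : Submodule S (Fin n → S)) : Prop :=
  shift u '' (D : Set (Fin n → S)) = D

/-- The class of `s₀ + s₁ z + ⋯ + sₙ₋₁ zⁿ⁻¹` in `S[z] / ⟨zⁿ - u⟩`. -/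
noncomputable def toClass (u : S) (s : Fin n → S) : AdjoinRoot (X ^ n - C u : S[X]) :=
  AdjoinRoot.mk (X ^ n - C u) (∑ i : Fin n, C (s i) * X ^ (i : ℕ))

end Words

/-- The coefficients `0`, `1` of binary words, read in another ring. -/
def bit (S : Type*) [CommRing S] (x : ZMod 2) : S := (x.val : S)

/-- The binary word of the class of `p` in `Z₂[z] / ⟨zⁿ - 1⟩`: the coefficients of the
representative of degree less than `n`. -/
noncomputable def word (n : ℕ) (p : (ZMod 2)[X]) : Fin n → ZMod 2 :=
  fun i => (p %ₘ (X ^ n - 1)).coeff i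

/-- A binary polynomial with its coefficients `0`, `1` read in `Z₄`. -/
noncomputable def lift4 (p : (ZMod 2)[X]) : (ZMod 4)[X] :=
  p.sum fun i a => monomial i (bit (ZMod 4) a)

section Associated

variable {θ : Theta} {n : ℕ}

/-- The residue code over `Z₄`: all `a` with `a + k_θ b` in the code for some `b`. -/
def residue (D : Set (Fin n → R θ)) : Set (Fin n → ZMod 4) :=
  {a | ∃ b : Fin n → ZMod 4,
    (fun i => algebraMap (ZMod 4) (R θ) (a i) + k θ * algebraMap (ZMod 4) (R θ) (b i)) ∈ D}

/-- The torsion code over `Z₄`: all `a` with `k_θ a` in the code. -/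
def torsion (D : Set (Fin n → R θ)) : Set (Fin n → ZMod 4) :=
  {a | (fun i => k θ * algebraMap (ZMod 4) (R θ) (a i)) ∈ D}

/-- The binary residue code of a code over `Z₄`. -/
def residue2 (D : Set (Fin n → ZMod 4)) : Set (Fin n → ZMod 2) :=
  {a | ∃ b : Fin n → ZMod 2, (fun i => bit (ZMod 4) (a i) + 2 * bit (ZMod 4) (b i)) ∈ D}

/-- The binary torsion code of a code over `Z₄`. -/
def torsion2 (D : Set (Fin n → ZMod 4)) : Set (Fin n → ZMod 2) :=
  {a | (fun i => 2 * bit (ZMod 4) (a i)) ∈ D}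

/-- The four binary codes associated with a code over `R_θ`: `Res (Res C)`, `Tor (Res C)`,
`Res (Tor C)`, `Tor (Tor C)`. -/
def assoc (D : Set (Fin n → R θ)) : Fin 4 → Set (Fin n → ZMod 2) :=
  ![residue2 (residue D), torsion2 (residue D), residue2 (torsion D), torsion2 (torsion D)]

end Associated

/-- `p` is nonzero and its class generates, in `Z₂[z] / ⟨zⁿ - 1⟩`, the binary code `D`. -/
def Generates (n : ℕ) [NeZero n] (D : Set (Fin n → ZMod 2)) (p : (ZMod 2)[X]) : Prop :=
  p ≠ 0 ∧ toClass (1 : ZMod 2) '' D =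
    (Ideal.span {AdjoinRoot.mk (X ^ n - C 1 : (ZMod 2)[X]) p} :
      Ideal (AdjoinRoot (X ^ n - C 1 : (ZMod 2)[X])))

/-- `p` has minimal degree among the nonzero polynomials that generate the binary code `D`. For the
zero code this is `zⁿ - 1`, whose class is zero. -/
def IsMinimalGenerator (n : ℕ) [NeZero n] (D : Set (Fin n → ZMod 2)) (p : (ZMod 2)[X]) : Prop :=
  Generates n D p ∧ ∀ q, Generates n D q → p.degree ≤ q.degree

/-- The word of `R_θ` with the polynomial `t i 0 + 2 t i 1 + k_θ t i 2 + 2 k_θ t i 3`. -/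
noncomputable def rowWord (θ : Theta) (n : ℕ) (t : Fin 4 → Fin 4 → (ZMod 2)[X]) (i : Fin 4) :
    Fin n → R θ :=
  fun m => bit (R θ) (word n (t i 0) m) + 2 * bit (R θ) (word n (t i 1) m)
    + k θ * bit (R θ) (word n (t i 2) m) + 2 * k θ * bit (R θ) (word n (t i 3) m)

/-- `t` is a triangular array of binary polynomials whose rows generate the code `D` as an ideal of
`R_θ[z] / ⟨zⁿ - u⟩`, whose diagonal entries are the minimal-degree generators of the associated
binary codes and whose other entries are zero or of degree less than that of the diagonal entry
in their column. -/
structure IsNormalForm {θ : Theta} {n : ℕ} [NeZero n] (u : R θ) (D : Submodule (R θ) (Fin n → R θ))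
    (t : Fin 4 → Fin 4 → (ZMod 2)[X]) : Prop where
  triangular : ∀ i j, j < i → t i j = 0
  generates : toClass u '' (D : Set (Fin n → R θ)) =
    (Ideal.span (Set.range fun i => toClass u (rowWord θ n t i)) :
      Ideal (AdjoinRoot (X ^ n - C u : (R θ)[X])))
  diagonal : ∀ i, IsMinimalGenerator n (assoc (D : Set (Fin n → R θ)) i) (t i i)
  degree_lt : ∀ i j, i < j → t i j = 0 ∨ (t i j).degree < (t j j).degree

/-- Either `p = 0`, or `deg p < deg a` and, in `Z₄[z]` and with coefficients `0`, `1` read in `Z₄`,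
`2 a` divides `((zⁿ - 1) / g) (g + 2 p) - (zⁿ - ε)`, the quotient being taken in `Z₂[z]`. -/
def ResidueCondition (n : ℕ) (ε : ZMod 4) (g p a : (ZMod 2)[X]) : Prop :=
  p = 0 ∨ (2 * lift4 a ∣ lift4 ((X ^ n - 1) / g) * (lift4 g + 2 * lift4 p) - (X ^ n - C ε) ∧
    p.degree < a.degree)

end Constacyclic

/-!
Every `x` in `R_θ` is uniquely `d₀ + 2 d₁ + k_θ d₂ + 2 k_θ d₃` with binary digits `dᵢ`. The
elements whose digits below the `i`-th vanish form an ideal on which the `i`-th digit is additive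
and semilinear over a ring homomorphism `R_θ → Z₂` (`digit_sub`, `digit_mul`): passing to
`R_θ / k_θ R_θ` for `i = 0, 1`, acting on `k_θ R_θ` for `i = 2, 3`, and reducing modulo `2`. All of this
carries over to polynomials, coefficient by coefficient. Hence an ideal `J` of `R_θ[z]` has four
ideals of leading digits (`leadIdeal`) in the principal ideal domain `Z₂[z]`, with generators
`g₀, …, g₃`, and behaves as if it had a Gröbner basis: a polynomial can be reduced modulo `J` so that
the digits after its leading one have degree less than that of the corresponding `gⱼ`
(`exists_reduced`), the result of such a reduction is unique (`eq_of_reduced`), and any elements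
of `J` with the leading digits `gⱼ` generate `J` (`mem_of_leadIdeal_le`).

A constacyclic code corresponds to an ideal of `R_θ[z]` that contains `zⁿ - α` (`codeIdeal`), and
its four associated binary codes correspond to the ideals of leading digits
(`mem_assoc_iff_ofWord_mem`). So the minimal generators of these codes are the `gᵢ`
(`isMinimalGenerator_iff`), and a normal form is the same as a reduced basis of the ideal
(`isNormalForm_iff`), which gives existence and uniqueness.

The product of `zⁿ - α` with `1`, `2`, `k_θ` or `2 k_θ` has the leading digit `zⁿ - 1`, so each
`gᵢ` divides `zⁿ - 1`; multiplication by `2` gives `g₁ ∣ g₀` and `g₃ ∣ g₂`. For the residue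
conditions, let `i = 0` or `2` and let `f` be the `i`-th row. Its leading digit is `gᵢ` unless
`gᵢ = zⁿ - 1`, and then the next digit vanishes (`polyDigit_eq_of_succ_ne_zero`). In the first case
`((zⁿ - 1) / gᵢ) f - (zⁿ - α)`, with `(zⁿ - α) k_θ` in place of `zⁿ - α` if `i = 2`, lies in the
ideal and its `i`-th digit vanishes, so its next digit is a multiple of `gᵢ₊₁`
(`residueCondition_zero`, `residueCondition_two`).
-/

namespace Constacyclic

/-! ### Binary digits in `R_θ` -/

theorem nontrivial_R (θ : Theta) : Nontrivial (R θ) := ⟨0, 1, by cases θ <;> decide⟩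

attribute [instance] nontrivial_R

/-- The underlying function of `residueHom`. -/
def residueFun : (θ : Theta) → R θ → ZMod 4
  | .zero, x => x.re
  | .one, x => x.re - x.im
  | .nu, x => x.re

/-- The quotient map `R_θ → R_θ / k_θ R_θ = Z₄`, that is `a + k_θ b ↦ a`. -/
def residueHom (θ : Theta) : R θ →+* ZMod 4 where
  toFun := residueFun θ
  map_zero' := by cases θ <;> decide
  map_one' := by cases θ <;> decide
  map_add' := by
    rintro ⟨a, b⟩ ⟨c, d⟩
    cases θ <;> revert a b c d <;> decide
  map_mul' := by
    rintro ⟨a, b⟩ ⟨c, d⟩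
    cases θ <;> revert a b c d <;> decide

/-- The action of `R_θ` on `k_θ R_θ = k_θ Z₄`, as a ring homomorphism to `Z₄`. -/
def torsionHom (θ : Theta) : R θ →+* ZMod 4 where
  toFun := epsilon θ
  map_zero' := by cases θ <;> decide
  map_one' := by cases θ <;> decide
  map_add' := by
    rintro ⟨a, b⟩ ⟨c, d⟩
    cases θ <;> revert a b c d <;> decide
  map_mul' := by
    rintro ⟨a, b⟩ ⟨c, d⟩
    cases θ <;> revert a b c d <;> decide

/-- The four digits of `x = d₀ + 2 d₁ + k_θ d₂ + 2 k_θ d₃`; since `x = a + k_θ b` with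
`a = residueHom θ x` and `b = x.im`, they are the binary digits of `a` and of `b`. -/
def digit (θ : Theta) : Fin 4 → R θ → ZMod 2 :=
  ![fun x => ((residueFun θ x).val : ZMod 2), fun x => (((residueFun θ x).val / 2 : ℕ) : ZMod 2),
    fun x => (x.im.val : ZMod 2), fun x => ((x.im.val / 2 : ℕ) : ZMod 2)]

/-- The element of `R_θ` with given digits. -/
def ofDigits (θ : Theta) (d : Fin 4 → ZMod 2) : R θ :=
  bit (R θ) (d 0) + 2 * bit (R θ) (d 1) + k θ * bit (R θ) (d 2) + 2 * k θ * bit (R θ) (d 3)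

/-- The ring homomorphism through which `R_θ` acts on the `i`-th leading digit. -/
def digitHom (θ : Theta) : Fin 4 → R θ →+* ZMod 2 :=
  ![(ZMod.castHom (by decide) (ZMod 2)).comp (residueHom θ),
    (ZMod.castHom (by decide) (ZMod 2)).comp (residueHom θ),
    (ZMod.castHom (by decide) (ZMod 2)).comp (torsionHom θ),
    (ZMod.castHom (by decide) (ZMod 2)).comp (torsionHom θ)]

/-- The element `1`, `2`, `k_θ` or `2 k_θ` whose `i`-th digit is `1` and whose other digits
vanish. -/
def place (θ : Theta) (i : Fin 4) : R θ := ofDigits θ (Pi.single i 1)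

theorem digit_zero (θ : Theta) (i : Fin 4) : digit θ i 0 = 0 := by
  revert i; cases θ <;> decide

theorem digit_ofDigits (θ : Theta) (d : Fin 4 → ZMod 2) (i : Fin 4) :
    digit θ i (ofDigits θ d) = d i := by
  obtain ⟨a, b, c, e, rfl⟩ : ∃ a b c e, d = ![a, b, c, e] :=
    ⟨d 0, d 1, d 2, d 3, by ext j; fin_cases j <;> rfl⟩
  revert a b c e i; cases θ <;> decide

theorem ofDigits_digit (θ : Theta) (x : R θ) : ofDigits θ (fun i => digit θ i x) = x := by
  obtain ⟨a, b⟩ := x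
  cases θ <;> revert a b <;> decide

/-- Subtracting an element whose digits below the `i`-th vanish does not change the digits below the
`i`-th, and causes no borrow in the `i`-th one. -/
theorem digit_sub (θ : Theta) (i : Fin 4) (x y : R θ) (hy : ∀ j < i, digit θ j y = 0) :
    (∀ j < i, digit θ j (x - y) = digit θ j x) ∧
      digit θ i (x - y) = digit θ i x - digit θ i y := by
  obtain ⟨a, b⟩ := x
  obtain ⟨c, d⟩ := y
  cases θ <;> revert i a b c d <;> decide

theorem digit_sub_eq_zero (θ : Theta) (i : Fin 4) (x y : R θ)
    (h : ∀ j < i, digit θ j x = digit θ j y) : ∀ j < i, digit θ j (x - y) = 0 := by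
  obtain ⟨a, b⟩ := x
  obtain ⟨c, d⟩ := y
  cases θ <;> revert i a b c d <;> decide

theorem digit_mul (θ : Theta) (i : Fin 4) (x y : R θ) (hy : ∀ j < i, digit θ j y = 0) :
    (∀ j < i, digit θ j (x * y) = 0) ∧
      digit θ i (x * y) = digitHom θ i x * digit θ i y := by
  obtain ⟨a, b⟩ := x
  obtain ⟨c, d⟩ := y
  cases θ <;> revert i a b c d <;> decide

theorem digitHom_bit (θ : Theta) (i : Fin 4) (x : ZMod 2) : digitHom θ i (bit (R θ) x) = x := by
  cases θ <;> revert i x <;> decide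

theorem digitHom_alpha (θ : Theta) (i : Fin 4) (u : R θ) (hu : IsAlpha θ u) :
    digitHom θ i u = 1 := by
  cases θ
  · rcases hu with rfl | rfl | rfl <;> revert i <;> decide
  · rcases hu with rfl | rfl | rfl <;> revert i <;> decide
  · obtain rfl : u = _ := hu
    revert i; decide

theorem residueHom_alpha (θ : Theta) (u : R θ) (hu : IsAlpha θ u) : residueHom θ u = 1 := by
  cases θ
  · rcases hu with rfl | rfl | rfl <;> decide
  · rcases hu with rfl | rfl | rfl <;> decide
  · obtain rfl : u = _ := hu
    decide

theorem epsilon_alpha (θ : Theta) (u : R θ) (hu : IsAlpha θ u) :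
    (ZMod.castHom (by decide) (ZMod 2) : ZMod 4 →+* ZMod 2) (epsilon θ u) = 1 :=
  digitHom_alpha θ 2 u hu

/-! ### Digits of polynomials -/

section CoeffMap

variable {A B : Type*} [Semiring A] [Semiring B]

/-- The polynomial obtained by applying a function, additive or not, to each coefficient. -/
noncomputable def coeffMap (s : A → B) (p : A[X]) : B[X] :=
  p.sum fun i a => monomial i (s a)

theorem coeff_coeffMap {s : A → B} (hs : s 0 = 0) (p : A[X]) (m : ℕ) :
    (coeffMap s p).coeff m = s (p.coeff m) := by
  simp only [coeffMap, Polynomial.sum, finsetSum_coeff, coeff_monomial, Finset.sum_ite_eq']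
  split_ifs with h
  · rfl
  · rw [notMem_support_iff.1 h, hs]

theorem degree_coeffMap_lt {s : A → B} (hs : s 0 = 0) {p : A[X]} {n : ℕ} (hp : p.degree < n) :
    (coeffMap s p).degree < n := by
  rw [degree_lt_iff_coeff_zero] at hp ⊢
  intro m hm
  rw [coeff_coeffMap hs, hp m hm, hs]

theorem coeff_monomial_mul_eq_ite (d : ℕ) (a : A) (f : A[X]) (m : ℕ) :
    (monomial d a * f).coeff m = if d ≤ m then a * f.coeff (m - d) else 0 := by
  rw [← C_mul_X_pow_eq_monomial, mul_assoc, coeff_C_mul, coeff_X_pow_mul', mul_ite, mul_zero]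

end CoeffMap

theorem bit_zero (S : Type*) [CommRing S] : bit S 0 = 0 := by simp [bit]

theorem coeff_lift4 (p : (ZMod 2)[X]) (m : ℕ) : (lift4 p).coeff m = bit (ZMod 4) (p.coeff m) :=
  coeff_coeffMap (bit_zero _) p m

variable {θ : Theta} {n : ℕ}

/-- The binary polynomial of the `i`-th digits of the coefficients. -/
noncomputable def polyDigit (i : Fin 4) (f : (R θ)[X]) : (ZMod 2)[X] := coeffMap (digit θ i) f

/-- A binary polynomial with its coefficients `0`, `1` read in `R_θ`. -/
noncomputable def liftR (θ : Theta) (p : (ZMod 2)[X]) : (R θ)[X] := coeffMap (bit (R θ)) p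

/-- The polynomial over `R_θ` with given digits. -/
noncomputable def polyOfDigits (θ : Theta) (t : Fin 4 → (ZMod 2)[X]) : (R θ)[X] :=
  liftR θ (t 0) + 2 * liftR θ (t 1) + C (k θ) * liftR θ (t 2) + 2 * C (k θ) * liftR θ (t 3)

/-- The digits of `f` below the `i`-th vanish. -/
def Above (i : Fin 4) (f : (R θ)[X]) : Prop := ∀ j < i, polyDigit j f = 0

theorem coeff_polyDigit (i : Fin 4) (f : (R θ)[X]) (m : ℕ) :
    (polyDigit i f).coeff m = digit θ i (f.coeff m) :=
  coeff_coeffMap (digit_zero θ i) f m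

theorem coeff_liftR (p : (ZMod 2)[X]) (m : ℕ) : (liftR θ p).coeff m = bit (R θ) (p.coeff m) :=
  coeff_coeffMap (bit_zero _) p m

theorem coeff_polyOfDigits (t : Fin 4 → (ZMod 2)[X]) (m : ℕ) :
    (polyOfDigits θ t).coeff m = ofDigits θ fun i => (t i).coeff m := by
  have h2 : (2 : (R θ)[X]) = C 2 := rfl
  simp only [polyOfDigits, ofDigits, coeff_add, h2, ← C_mul, coeff_C_mul, coeff_liftR]

theorem polyOfDigits_polyDigit (f : (R θ)[X]) : polyOfDigits θ (fun i => polyDigit i f) = f := by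
  ext1 m
  simp only [coeff_polyOfDigits, coeff_polyDigit, ofDigits_digit]

theorem eq_of_polyDigit_eq {f g : (R θ)[X]} (h : ∀ i, polyDigit i f = polyDigit i g) : f = g := by
  rw [← polyOfDigits_polyDigit f, ← polyOfDigits_polyDigit g, funext h]

theorem polyDigit_zero (i : Fin 4) : polyDigit i (0 : (R θ)[X]) = 0 := by
  ext m
  rw [coeff_polyDigit, coeff_zero, coeff_zero, digit_zero]

theorem Above.coeff {i : Fin 4} {f : (R θ)[X]} (hf : Above i f) (m : ℕ) :
    ∀ j < i, digit θ j (f.coeff m) = 0 := fun j hj => by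
  rw [← coeff_polyDigit, hf j hj, coeff_zero]

theorem polyDigit_sub_of_lt {i : Fin 4} (f : (R θ)[X]) {g : (R θ)[X]} (hg : Above i g) {j : Fin 4}
    (hj : j < i) : polyDigit j (f - g) = polyDigit j f := by
  ext m
  rw [coeff_polyDigit, coeff_polyDigit, coeff_sub, (digit_sub θ i _ _ (hg.coeff m)).1 j hj]

theorem polyDigit_sub {i : Fin 4} (f : (R θ)[X]) {g : (R θ)[X]} (hg : Above i g) :
    polyDigit i (f - g) = polyDigit i f - polyDigit i g := by
  ext m
  rw [coeff_sub, coeff_polyDigit, coeff_polyDigit, coeff_polyDigit, coeff_sub,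
    (digit_sub θ i _ _ (hg.coeff m)).2]

theorem Above.zero (i : Fin 4) : Above i (0 : (R θ)[X]) := fun j _ => polyDigit_zero j

theorem Above.sub {i : Fin 4} {f g : (R θ)[X]} (hf : Above i f) (hg : Above i g) :
    Above i (f - g) := fun j hj => by rw [polyDigit_sub_of_lt f hg hj, hf j hj]

theorem Above.neg {i : Fin 4} {f : (R θ)[X]} (hf : Above i f) : Above i (-f) := by
  simpa using (Above.zero i).sub hf

theorem Above.add {i : Fin 4} {f g : (R θ)[X]} (hf : Above i f) (hg : Above i g) :
    Above i (f + g) := by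
  simpa using hf.sub hg.neg

theorem polyDigit_add {i : Fin 4} (f : (R θ)[X]) {g : (R θ)[X]} (hg : Above i g) :
    polyDigit i (f + g) = polyDigit i f + polyDigit i g := by
  have h : polyDigit i (f - -g) = _ := polyDigit_sub f hg.neg
  have h' : polyDigit i (0 - g) = _ := polyDigit_sub 0 hg
  rw [polyDigit_zero, zero_sub, zero_sub] at h'
  rwa [h', sub_neg_eq_add, sub_neg_eq_add] at h

/-- Polynomials over `R_θ` act on the `i`-th leading digit through `digitHom θ i`. -/
theorem above_mul_and_polyDigit_mul {i : Fin 4} (h : (R θ)[X]) {f : (R θ)[X]} (hf : Above i f) :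
    Above i (h * f) ∧ polyDigit i (h * f) = h.map (digitHom θ i) * polyDigit i f := by
  induction h using Polynomial.induction_on' with
  | add p q hp hq =>
    rw [add_mul, polyDigit_add _ hq.1, hp.2, hq.2, Polynomial.map_add, add_mul]
    exact ⟨hp.1.add hq.1, rfl⟩
  | monomial d a =>
    refine ⟨fun j hj => ?_, ?_⟩
    · ext m
      rw [coeff_polyDigit, coeff_monomial_mul_eq_ite]
      split_ifs
      · exact (digit_mul θ i _ _ (hf.coeff _)).1 j hj
      · exact digit_zero θ j
    · ext m
      rw [map_monomial, coeff_monomial_mul_eq_ite, coeff_polyDigit, coeff_monomial_mul_eq_ite,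
        coeff_polyDigit]
      split_ifs
      · exact (digit_mul θ i _ _ (hf.coeff _)).2
      · exact digit_zero θ i

theorem Above.mul {i : Fin 4} (h : (R θ)[X]) {f : (R θ)[X]} (hf : Above i f) : Above i (h * f) :=
  (above_mul_and_polyDigit_mul h hf).1

theorem polyDigit_mul {i : Fin 4} (h : (R θ)[X]) {f : (R θ)[X]} (hf : Above i f) :
    polyDigit i (h * f) = h.map (digitHom θ i) * polyDigit i f :=
  (above_mul_and_polyDigit_mul h hf).2

theorem map_liftR (i : Fin 4) (p : (ZMod 2)[X]) : (liftR θ p).map (digitHom θ i) = p := by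
  ext m
  rw [coeff_map, coeff_liftR, digitHom_bit]

theorem polyDigit_place (i j : Fin 4) :
    polyDigit j (C (place θ i)) = if j = i then 1 else 0 := by
  ext m
  rw [coeff_polyDigit, coeff_C]
  split_ifs with h1 h2 h2
  · rw [place, digit_ofDigits, h2, h1]; simp
  · rw [place, digit_ofDigits]; simp [h2]
  · rw [digit_zero, coeff_one, if_neg h1]
  · rw [digit_zero, coeff_zero]

theorem above_place (i : Fin 4) : Above i (C (place θ i)) := fun j hj => by
  rw [polyDigit_place, if_neg hj.ne]

/-! ### Ideals of leading digits -/

/-- The `i`-th digits of those elements of `J` whose digits below the `i`-th vanish. -/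
noncomputable def leadIdeal (J : Ideal (R θ)[X]) (i : Fin 4) : Ideal (ZMod 2)[X] where
  carrier := {p | ∃ f ∈ J, Above i f ∧ polyDigit i f = p}
  zero_mem' := ⟨0, J.zero_mem, Above.zero i, polyDigit_zero i⟩
  add_mem' := by
    rintro _ _ ⟨f, hf, hf', rfl⟩ ⟨g, hg, hg', rfl⟩
    exact ⟨f + g, J.add_mem hf hg, hf'.add hg', polyDigit_add f hg'⟩
  smul_mem' := by
    rintro c _ ⟨f, hf, hf', rfl⟩
    exact ⟨liftR θ c * f, J.mul_mem_left _ hf, hf'.mul _, by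
      rw [polyDigit_mul _ hf', map_liftR, smul_eq_mul]⟩

theorem polyDigit_mem_leadIdeal {J : Ideal (R θ)[X]} {i : Fin 4} {f : (R θ)[X]} (hf : f ∈ J)
    (hf' : Above i f) : polyDigit i f ∈ leadIdeal J i := ⟨f, hf, hf', rfl⟩

theorem polyDigit_modulus {α : R θ} (hα : IsAlpha θ α) (i : Fin 4) :
    polyDigit i ((X ^ n - C α) * C (place θ i)) = X ^ n - 1 := by
  rw [polyDigit_mul _ (above_place i), polyDigit_place, if_pos rfl, mul_one, Polynomial.map_sub,
    Polynomial.map_pow, map_X, map_C, digitHom_alpha θ i α hα, C_1]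

theorem modulus_mem_leadIdeal {α : R θ} (hα : IsAlpha θ α) {J : Ideal (R θ)[X]}
    (hJ : X ^ n - C α ∈ J) (i : Fin 4) : X ^ n - 1 ∈ leadIdeal J i :=
  ⟨_, J.mul_mem_right _ hJ, (above_place i).mul _, polyDigit_modulus hα i⟩

/-- Multiples of elements with leading digits `g j` reduce, for all `j > i`, the `j`-th digit modulo
`g j`; the digits up to the `i`-th stay the same. -/
theorem exists_reduced {J : Ideal (R θ)[X]} {g : Fin 4 → (ZMod 2)[X]} (hg0 : ∀ j, g j ≠ 0)
    (hg : ∀ j, g j ∈ leadIdeal J j) (i : Fin 4) {f : (R θ)[X]} (hf : f ∈ J) :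
    ∃ f' ∈ J, (∀ l ≤ i, polyDigit l f' = polyDigit l f) ∧
      ∀ j, i < j → (polyDigit j f').degree < (g j).degree := by
  suffices H : ∀ m : ℕ, ∃ f' ∈ J, (∀ l ≤ i, polyDigit l f' = polyDigit l f) ∧
      ∀ j : Fin 4, i < j → (j : ℕ) < m → (polyDigit j f').degree < (g j).degree by
    obtain ⟨f', h1, h2, h3⟩ := H 4
    exact ⟨f', h1, h2, fun j hj => h3 j hj j.isLt⟩
  intro m
  induction m with
  | zero => exact ⟨f, hf, fun _ _ => rfl, fun _ _ h => absurd h (Nat.not_lt_zero _)⟩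
  | succ m ih =>
    obtain ⟨f', h1, h2, h3⟩ := ih
    by_cases hm : (i : ℕ) < m ∧ m < 4
    · obtain ⟨e, he, he', hge⟩ := hg ⟨m, hm.2⟩
      have hA := he'.mul (liftR θ (polyDigit ⟨m, hm.2⟩ f' / g ⟨m, hm.2⟩))
      refine ⟨f' - _, J.sub_mem h1 (J.mul_mem_left (liftR θ (polyDigit ⟨m, hm.2⟩ f' /
        g ⟨m, hm.2⟩)) he), fun l hl => ?_, fun j hj hjm => ?_⟩
      · rw [polyDigit_sub_of_lt _ hA (lt_of_le_of_lt hl (Fin.lt_def.2 hm.1)), h2 l hl]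
      · obtain hlt | heq := Nat.lt_succ_iff_lt_or_eq.1 hjm
        · rw [polyDigit_sub_of_lt _ hA (Fin.lt_def.2 hlt)]
          exact h3 j hj hlt
        · obtain rfl : j = ⟨m, hm.2⟩ := Fin.ext heq
          rw [polyDigit_sub _ hA, polyDigit_mul _ he', map_liftR, hge, mul_comm,
            ← EuclideanDomain.mod_eq_sub_mul_div]
          exact EuclideanDomain.mod_lt _ (hg0 _)
    · refine ⟨f', h1, h2, fun j hj hjm => h3 j hj ?_⟩
      have := Fin.lt_def.1 hj
      omega

/-- An ideal contained in `J` with the same leading digits is all of `J`. -/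
theorem mem_of_leadIdeal_le {J K : Ideal (R θ)[X]} (hKJ : K ≤ J)
    (hle : ∀ j, leadIdeal J j ≤ leadIdeal K j) {f : (R θ)[X]} (hf : f ∈ J) : f ∈ K := by
  suffices H : ∀ m : ℕ, ∃ h ∈ K, ∀ j : Fin 4, (j : ℕ) < m → polyDigit j (f - h) = 0 by
    obtain ⟨h, hK, hh⟩ := H 4
    have : f - h = 0 := eq_of_polyDigit_eq fun j => by rw [hh j j.isLt, polyDigit_zero]
    rwa [sub_eq_zero.1 this]
  intro m
  induction m with
  | zero => exact ⟨0, K.zero_mem, fun _ h => absurd h (Nat.not_lt_zero _)⟩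
  | succ m ih =>
    obtain ⟨h, hK, hh⟩ := ih
    by_cases hm : m < 4
    · obtain ⟨e, he, he', hfe⟩ := hle ⟨m, hm⟩
        (polyDigit_mem_leadIdeal (J.sub_mem hf (hKJ hK)) fun j hj => hh j (Fin.lt_def.1 hj))
      refine ⟨h + e, K.add_mem hK he, fun j hj => ?_⟩
      rw [← sub_sub]
      obtain hlt | heq := Nat.lt_succ_iff_lt_or_eq.1 hj
      · rw [polyDigit_sub_of_lt _ he' (Fin.lt_def.2 hlt), hh j hlt]
      · obtain rfl : j = ⟨m, hm⟩ := Fin.ext heq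
        rw [polyDigit_sub _ he', hfe, sub_self]
    · exact ⟨h, hK, fun j hj => hh j (by omega)⟩

theorem eq_zero_of_mem_of_degree_lt {I : Ideal (ZMod 2)[X]} {g p : (ZMod 2)[X]}
    (hI : I = Ideal.span {g}) (hp : p ∈ I) (hd : p.degree < g.degree) : p = 0 :=
  eq_zero_of_dvd_of_degree_lt (Ideal.mem_span_singleton.1 (hI ▸ hp)) hd

/-- Reduced elements of `J` are determined by their digits up to the `i`-th: the first digit in
which two of them differ gives a leading digit of their difference, a multiple of `g j` of smaller
degree. -/
theorem eq_of_reduced {J : Ideal (R θ)[X]} {g : Fin 4 → (ZMod 2)[X]}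
    (hg : ∀ j, leadIdeal J j = Ideal.span {g j}) {i : Fin 4} {f f' : (R θ)[X]} (hf : f ∈ J)
    (hf' : f' ∈ J) (hle : ∀ l ≤ i, polyDigit l f = polyDigit l f')
    (hd : ∀ j, i < j → (polyDigit j f).degree < (g j).degree)
    (hd' : ∀ j, i < j → (polyDigit j f').degree < (g j).degree) : f = f' := by
  suffices H : ∀ m : ℕ, ∀ j : Fin 4, (j : ℕ) = m → polyDigit j f = polyDigit j f' from
    eq_of_polyDigit_eq fun j => H j j rfl
  intro m
  induction m using Nat.strong_induction_on with
  | _ m ih =>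
    rintro j rfl
    obtain hj | hj := le_or_gt j i
    · exact hle j hj
    have hA : Above j (f - f') := fun l hl => by
      ext m
      rw [coeff_polyDigit, coeff_sub, coeff_zero]
      refine digit_sub_eq_zero θ j _ _ (fun a ha => ?_) l hl
      rw [← coeff_polyDigit, ← coeff_polyDigit, ih a ha a rfl]
    have hs : polyDigit j (f - f') = polyDigit j f - polyDigit j f' := by
      have := polyDigit_add f' hA
      rw [add_sub_cancel] at this
      rw [this, add_sub_cancel_left]
    have h0 := eq_zero_of_mem_of_degree_lt (hg j) (polyDigit_mem_leadIdeal (J.sub_mem hf hf') hA)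
      (hs ▸ (degree_sub_le _ _).trans_lt (max_lt (hd j hj) (hd' j hj)))
    exact sub_eq_zero.1 (hs ▸ h0)


/-! ### Constacyclic codes as ideals of the polynomial ring -/

section CodeIdeal

variable {S : Type*} [CommRing S] {n : ℕ}

/-- The polynomial `w₀ + w₁ z + ⋯ + wₙ₋₁ zⁿ⁻¹` of a word. -/
noncomputable def ofWord (w : Fin n → S) : S[X] := ∑ i : Fin n, C (w i) * X ^ (i : ℕ)

theorem coeff_ofWord (w : Fin n → S) (i : Fin n) : (ofWord w).coeff i = w i := by
  simp [ofWord, finsetSum_coeff, coeff_X_pow, Fin.val_inj]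

theorem degree_ofWord_lt (w : Fin n → S) : (ofWord w).degree < n := by
  rw [degree_lt_iff_coeff_zero]
  intro m hm
  rw [ofWord, finsetSum_coeff]
  refine Finset.sum_eq_zero fun i _ => ?_
  rw [coeff_C_mul_X_pow, if_neg (by omega)]

theorem eq_of_coeff_eq_of_degree_lt {p q : S[X]} (hp : p.degree < n) (hq : q.degree < n)
    (h : ∀ i : Fin n, p.coeff i = q.coeff i) : p = q := by
  rw [degree_lt_iff_coeff_zero] at hp hq
  ext m
  by_cases hm : m < n
  · exact h ⟨m, hm⟩
  · rw [hp m (not_lt.1 hm), hq m (not_lt.1 hm)]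

theorem ofWord_coeff {p : S[X]} (hp : p.degree < n) : ofWord (fun i : Fin n => p.coeff i) = p :=
  eq_of_coeff_eq_of_degree_lt (degree_ofWord_lt _) hp fun i => coeff_ofWord _ i

theorem toClass_eq_mk (u : S) (w : Fin n → S) :
    toClass u w = AdjoinRoot.mk (X ^ n - C u) (ofWord w) := rfl

variable [NeZero n]

theorem monic_modulus (n : ℕ) [NeZero n] (u : S) : (X ^ n - C u : S[X]).Monic :=
  monic_X_pow_sub_C u (NeZero.ne n)

theorem degree_modulus [Nontrivial S] (n : ℕ) [NeZero n] (u : S) :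
    (X ^ n - C u : S[X]).degree = n :=
  degree_X_pow_sub_C (NeZero.pos n) u

theorem toClass_injective [Nontrivial S] (u : S) :
    Function.Injective (toClass u : (Fin n → S) → _) := by
  intro v w h
  rw [toClass_eq_mk, toClass_eq_mk, AdjoinRoot.mk_eq_mk] at h
  have h0 : ofWord v - ofWord w = 0 := by
    by_contra hne
    refine (monic_modulus n u).not_dvd_of_degree_lt hne ?_ h
    rw [degree_modulus]
    exact (degree_sub_le _ _).trans_lt (max_lt (degree_ofWord_lt v) (degree_ofWord_lt w))
  funext i
  rw [← coeff_ofWord v i, ← coeff_ofWord w i, sub_eq_zero.1 h0]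

/-- Multiplication by `z` modulo `zⁿ - u` is the constacyclic shift. -/
theorem mk_X_mul_ofWord (u : S) (w : Fin n → S) :
    AdjoinRoot.mk (X ^ n - C u) (X * ofWord w) = toClass u (shift u w) := by
  obtain _ | n := n
  · exact absurd rfl (NeZero.ne 0)
  rw [toClass_eq_mk, AdjoinRoot.mk_eq_mk]
  refine ⟨C (w (Fin.last n)), ?_⟩
  have h0 : shift u w 0 = u * w (Fin.last n) := by
    simp only [shift, if_true]
    congr 2
    ext
    simp
  have hs (i : Fin n) : shift u w i.succ = w i.castSucc := by
    simp only [shift, Fin.succ_ne_zero, if_false]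
    congr 1
    rw [sub_eq_iff_eq_add, ← Fin.coeSucc_eq_succ]
  rw [ofWord, ofWord, Fin.sum_univ_castSucc, Fin.sum_univ_succ]
  simp only [h0, hs, Fin.val_succ, Fin.val_castSucc, Fin.val_last, Fin.val_zero, C_mul, mul_add,
    Finset.mul_sum, pow_succ]
  have : ∀ i : Fin n, X * (C (w i.castSucc) * X ^ (i : ℕ)) = C (w i.castSucc) * (X ^ (i : ℕ) * X) :=
    fun i => by ring
  simp only [this]
  ring

/-- The ideal of all polynomials whose class modulo `zⁿ - u` is that of a codeword. -/
noncomputable def codeIdeal (u : S) (D : Submodule S (Fin n → S)) (hD : IsConstacyclic u D) :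
    Ideal S[X] where
  carrier := {p | ∃ w ∈ D, AdjoinRoot.mk (X ^ n - C u) p = toClass u w}
  zero_mem' := ⟨0, D.zero_mem, by simp [toClass]⟩
  add_mem' := by
    rintro p q ⟨v, hv, hp⟩ ⟨w, hw, hq⟩
    refine ⟨v + w, D.add_mem hv hw, ?_⟩
    rw [map_add, hp, hq]
    simp [toClass, add_mul, Finset.sum_add_distrib]
  smul_mem' := by
    rintro c p hp
    rw [smul_eq_mul]
    induction c using Polynomial.induction_on generalizing p with
    | C a =>
      obtain ⟨w, hw, hp⟩ := hp
      refine ⟨a • w, D.smul_mem a hw, ?_⟩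
      rw [map_mul, hp]
      simp [toClass, Finset.mul_sum, mul_assoc]
    | add f g hf hg =>
      obtain ⟨v, hv, hp'⟩ := hf hp
      obtain ⟨w, hw, hq'⟩ := hg hp
      refine ⟨v + w, D.add_mem hv hw, ?_⟩
      rw [add_mul, map_add, hp', hq']
      simp [toClass, add_mul, Finset.sum_add_distrib]
    | monomial d a ih =>
      have : C a * X ^ (d + 1) * p = C a * X ^ d * (X * p) := by ring
      rw [this]
      refine ih ?_
      obtain ⟨w, hw, hp⟩ := hp
      refine ⟨shift u w, ?_, ?_⟩
      · rw [← SetLike.mem_coe, ← hD]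
        exact ⟨w, hw, rfl⟩
      · rw [map_mul, hp, ← mk_X_mul_ofWord, map_mul, toClass_eq_mk]

variable {u : S} {D : Submodule S (Fin n → S)} (hD : IsConstacyclic u D)

theorem modulus_mem_codeIdeal : X ^ n - C u ∈ codeIdeal u D hD :=
  ⟨0, D.zero_mem, by rw [AdjoinRoot.mk_self]; simp [toClass]⟩

theorem ofWord_mem_codeIdeal [Nontrivial S] {w : Fin n → S} :
    ofWord w ∈ codeIdeal u D hD ↔ w ∈ D := by
  refine ⟨?_, fun h => ⟨w, h, rfl⟩⟩
  rintro ⟨v, hv, h⟩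
  rwa [toClass_injective u h]

theorem image_toClass : toClass u '' (D : Set (Fin n → S)) =
    ((codeIdeal u D hD).map (AdjoinRoot.mk (X ^ n - C u)) : Set _) := by
  ext x
  rw [SetLike.mem_coe, Ideal.mem_map_iff_of_surjective _ AdjoinRoot.mk_surjective]
  constructor
  · rintro ⟨w, hw, rfl⟩
    exact ⟨ofWord w, ⟨w, hw, rfl⟩, rfl⟩
  · rintro ⟨p, ⟨w, hw, hp⟩, rfl⟩
    exact ⟨w, hw, hp.symm⟩

end CodeIdeal

/-! ### Minimal generators of binary cyclic codes -/

theorem eq_of_span_eq {p q : (ZMod 2)[X]} (h : Ideal.span {p} = Ideal.span {q}) : p = q := by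
  obtain ⟨v, rfl⟩ := Ideal.span_singleton_eq_span_singleton.1 h
  obtain ⟨r, hr, hv⟩ := Polynomial.isUnit_iff.1 v.isUnit
  have : ∀ r : ZMod 2, IsUnit r → r = 1 := by decide
  rw [← hv, this r hr, C_1, mul_one]

theorem mod_modulus_mem {n : ℕ} {I : Ideal (ZMod 2)[X]} (hI : X ^ n - 1 ∈ I) {p : (ZMod 2)[X]}
    (hp : p ∈ I) :
    p %ₘ (X ^ n - 1) ∈ I := by
  rw [modByMonic_eq_sub_mul_div]
  exact I.sub_mem hp (I.mul_mem_right _ hI)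

section Minimal

variable {n : ℕ} [NeZero n] {B : Set (Fin n → ZMod 2)} {I : Ideal (ZMod 2)[X]}

theorem monic_X_pow_sub_one (n : ℕ) [NeZero n] : (X ^ n - 1 : (ZMod 2)[X]).Monic := by
  simpa using monic_modulus n (1 : ZMod 2)

theorem degree_X_pow_sub_one (n : ℕ) [NeZero n] : (X ^ n - 1 : (ZMod 2)[X]).degree = n := by
  simpa using degree_modulus n (1 : ZMod 2)

theorem degree_mod_modulus_lt (n : ℕ) [NeZero n] (p : (ZMod 2)[X]) :
    (p %ₘ (X ^ n - 1)).degree < n :=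
  degree_X_pow_sub_one n ▸ degree_modByMonic_lt p (monic_X_pow_sub_one n)

theorem image_toClass_one (hI : X ^ n - 1 ∈ I) (hB : ∀ a, a ∈ B ↔ ofWord a ∈ I) :
    toClass (1 : ZMod 2) '' B = (I.map (AdjoinRoot.mk (X ^ n - C 1 : (ZMod 2)[X])) : Set _) := by
  ext x
  rw [SetLike.mem_coe, Ideal.mem_map_iff_of_surjective _ AdjoinRoot.mk_surjective]
  constructor
  · rintro ⟨w, hw, rfl⟩
    exact ⟨ofWord w, (hB w).1 hw, rfl⟩
  · rintro ⟨p, hp, rfl⟩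
    have h := degree_mod_modulus_lt n p
    refine ⟨fun i => (p %ₘ (X ^ n - 1)).coeff i, ?_, ?_⟩
    · rw [hB, ofWord_coeff h]
      exact mod_modulus_mem hI hp
    · rw [toClass_eq_mk, ofWord_coeff h, AdjoinRoot.mk_eq_mk, C_1, modByMonic_eq_sub_mul_div,
        sub_sub_cancel_left, dvd_neg]
      exact dvd_mul_right _ _

/-- The minimal generator of a binary cyclic code is the generator of the ideal of all polynomials
whose class belongs to the code; `zⁿ - 1` is the one for the zero code. -/
theorem isMinimalGenerator_iff (hI : X ^ n - 1 ∈ I) (hB : ∀ a, a ∈ B ↔ ofWord a ∈ I)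
    {p : (ZMod 2)[X]} : IsMinimalGenerator n B p ↔ I = Ideal.span {p} := by
  have hgen {q : (ZMod 2)[X]} (hq : Generates n B q) : q ∈ I := by
    have h : AdjoinRoot.mk (X ^ n - C 1 : (ZMod 2)[X]) q ∈ toClass (1 : ZMod 2) '' B := by
      rw [hq.2]
      exact Ideal.subset_span rfl
    obtain ⟨a, ha, hq'⟩ := h
    rw [toClass_eq_mk, eq_comm, AdjoinRoot.mk_eq_mk, C_1] at hq'
    have := I.add_mem (I.mem_of_dvd hq' hI) ((hB a).1 ha)
    rwa [sub_add_cancel] at this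
  have hspan {q : (ZMod 2)[X]} (hq : I = Ideal.span {q}) : Generates n B q := by
    refine ⟨?_, ?_⟩
    · rintro rfl
      rw [hq, Ideal.mem_span_singleton, zero_dvd_iff] at hI
      exact (monic_X_pow_sub_one n).ne_zero hI
    · rw [image_toClass_one hI hB, hq, Ideal.map_span, Set.image_singleton]
  constructor
  · rintro ⟨h1, h2⟩
    obtain ⟨g, hg⟩ := (IsPrincipalIdealRing.principal I).principal
    have hg : I = Ideal.span {g} := hg
    have hd : g ∣ p := Ideal.mem_span_singleton.1 (hg ▸ hgen h1)
    rw [hg, Ideal.span_singleton_eq_span_singleton]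
    have hle := h2 g (hspan hg)
    obtain ⟨c, rfl⟩ := hd
    have hc : c ≠ 0 := right_ne_zero_of_mul h1.1
    have hg0 : g ≠ 0 := left_ne_zero_of_mul h1.1
    rw [degree_mul, degree_eq_natDegree hc, degree_eq_natDegree hg0] at hle
    have hu : IsUnit c := by
      rw [isUnit_iff_degree_eq_zero, degree_eq_natDegree hc]
      norm_cast at hle ⊢
      omega
    exact associated_mul_unit_right g c hu
  · intro h
    refine ⟨hspan h, fun q hq => ?_⟩
    exact degree_le_of_dvd (Ideal.mem_span_singleton.1 (h ▸ hgen hq)) hq.1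

end Minimal


/-! ### The binary codes associated with a constacyclic code -/

theorem digit_add_k_mul (θ : Theta) (a b : ZMod 2) (c : ZMod 4) :
    digit θ 0 (algebraMap (ZMod 4) (R θ) (bit (ZMod 4) a + 2 * bit (ZMod 4) b)
      + k θ * algebraMap (ZMod 4) (R θ) c) = a ∧
    digit θ 1 (algebraMap (ZMod 4) (R θ) (bit (ZMod 4) a + 2 * bit (ZMod 4) b)
      + k θ * algebraMap (ZMod 4) (R θ) c) = b := by
  cases θ <;> revert a b c <;> decide

theorem digit_two_mul_add_k_mul (θ : Theta) (a : ZMod 2) (c : ZMod 4) :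
    digit θ 0 (algebraMap (ZMod 4) (R θ) (2 * bit (ZMod 4) a)
      + k θ * algebraMap (ZMod 4) (R θ) c) = 0 ∧
    digit θ 1 (algebraMap (ZMod 4) (R θ) (2 * bit (ZMod 4) a)
      + k θ * algebraMap (ZMod 4) (R θ) c) = a := by
  cases θ <;> revert a c <;> decide

theorem digit_k_mul (θ : Theta) (a b : ZMod 2) :
    (∀ j < 2, digit θ j
      (k θ * algebraMap (ZMod 4) (R θ) (bit (ZMod 4) a + 2 * bit (ZMod 4) b)) = 0) ∧
    digit θ 2 (k θ * algebraMap (ZMod 4) (R θ) (bit (ZMod 4) a + 2 * bit (ZMod 4) b)) = a := by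
  cases θ <;> revert a b <;> decide

theorem digit_k_mul_two_mul (θ : Theta) (a : ZMod 2) :
    (∀ j < 3, digit θ j (k θ * algebraMap (ZMod 4) (R θ) (2 * bit (ZMod 4) a)) = 0) ∧
    digit θ 3 (k θ * algebraMap (ZMod 4) (R θ) (2 * bit (ZMod 4) a)) = a := by
  cases θ <;> revert a <;> decide

theorem eq_add_k_mul (θ : Theta) (x : R θ) :
    algebraMap (ZMod 4) (R θ) (bit (ZMod 4) (digit θ 0 x) + 2 * bit (ZMod 4) (digit θ 1 x))
      + k θ * algebraMap (ZMod 4) (R θ) x.im = x := by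
  obtain ⟨a, b⟩ := x
  cases θ <;> revert a b <;> decide

theorem eq_two_mul_add_k_mul (θ : Theta) (x : R θ) (h : ∀ j < 1, digit θ j x = 0) :
    algebraMap (ZMod 4) (R θ) (2 * bit (ZMod 4) (digit θ 1 x))
      + k θ * algebraMap (ZMod 4) (R θ) x.im = x := by
  obtain ⟨a, b⟩ := x
  cases θ <;> revert a b <;> decide

theorem eq_k_mul (θ : Theta) (x : R θ) (h : ∀ j < 2, digit θ j x = 0) :
    k θ * algebraMap (ZMod 4) (R θ) (bit (ZMod 4) (digit θ 2 x) + 2 * bit (ZMod 4) (digit θ 3 x))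
      = x := by
  obtain ⟨a, b⟩ := x
  cases θ <;> revert a b <;> decide

theorem eq_k_mul_two_mul (θ : Theta) (x : R θ) (h : ∀ j < 3, digit θ j x = 0) :
    k θ * algebraMap (ZMod 4) (R θ) (2 * bit (ZMod 4) (digit θ 3 x)) = x := by
  obtain ⟨a, b⟩ := x
  cases θ <;> revert a b <;> decide

variable {θ : Theta} {n : ℕ}

/-- The words of the `i`-th associated code are the `i`-th digits of the codewords whose digits
below the `i`-th vanish. -/
theorem mem_assoc_iff (D : Set (Fin n → R θ)) (i : Fin 4) (a : Fin n → ZMod 2) :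
    a ∈ assoc D i ↔
      ∃ w ∈ D, ∀ m, (∀ j < i, digit θ j (w m) = 0) ∧ digit θ i (w m) = a m := by
  fin_cases i
  · constructor
    · rintro ⟨b, c, h⟩
      exact ⟨_, h, fun m => ⟨fun j hj => absurd hj (Fin.not_lt_zero j),
        (digit_add_k_mul θ _ _ _).1⟩⟩
    · rintro ⟨w, hw, h⟩
      obtain rfl : (fun m => digit θ 0 (w m)) = a := funext fun m => (h m).2
      refine ⟨fun m => digit θ 1 (w m), fun m => (w m).im, ?_⟩
      convert hw using 1
      exact funext fun m => eq_add_k_mul θ (w m)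
  · constructor
    · rintro ⟨c, h⟩
      refine ⟨_, h, fun m => ⟨fun j hj => ?_, (digit_two_mul_add_k_mul θ _ _).2⟩⟩
      obtain rfl := Fin.lt_one_iff j |>.1 hj
      exact (digit_two_mul_add_k_mul θ _ _).1
    · rintro ⟨w, hw, h⟩
      obtain rfl : (fun m => digit θ 1 (w m)) = a := funext fun m => (h m).2
      refine ⟨fun m => (w m).im, ?_⟩
      convert hw using 1
      exact funext fun m => eq_two_mul_add_k_mul θ (w m) (h m).1
  · constructor
    · rintro ⟨b, h⟩
      exact ⟨_, h, fun m => digit_k_mul θ _ _⟩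
    · rintro ⟨w, hw, h⟩
      obtain rfl : (fun m => digit θ 2 (w m)) = a := funext fun m => (h m).2
      refine ⟨fun m => digit θ 3 (w m), ?_⟩
      change (fun m => _) ∈ D
      convert hw using 1
      exact funext fun m => eq_k_mul θ (w m) (h m).1
  · constructor
    · intro h
      exact ⟨_, h, fun m => digit_k_mul_two_mul θ _⟩
    · rintro ⟨w, hw, h⟩
      obtain rfl : (fun m => digit θ 3 (w m)) = a := funext fun m => (h m).2
      change (fun m => _) ∈ D
      convert hw using 1
      exact funext fun m => eq_k_mul_two_mul θ (w m) (h m).1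

theorem polyDigit_ofWord (j : Fin 4) (w : Fin n → R θ) :
    polyDigit j (ofWord w) = ofWord fun m => digit θ j (w m) :=
  eq_of_coeff_eq_of_degree_lt (degree_coeffMap_lt (digit_zero θ j) (degree_ofWord_lt w))
    (degree_ofWord_lt _) fun m => by rw [coeff_polyDigit, coeff_ofWord, coeff_ofWord]

theorem degree_lt_of_polyDigit {f : (R θ)[X]} (h : ∀ j, (polyDigit j f).degree < n) :
    f.degree < n := by
  rw [degree_lt_iff_coeff_zero]
  intro m hm
  rw [← polyOfDigits_polyDigit f, coeff_polyOfDigits]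
  have : (fun i => (polyDigit i f).coeff m) = fun _ => 0 :=
    funext fun j => (degree_lt_iff_coeff_zero _ _).1 (h j) m hm
  rw [this]
  simp [ofDigits, bit_zero]

variable {α : R θ} {g : Fin 4 → (ZMod 2)[X]}

theorem dvd_modulus {J : Ideal (R θ)[X]} (hα : IsAlpha θ α)
    (hJ : X ^ n - C α ∈ J) (hg : ∀ j, leadIdeal J j = Ideal.span {g j}) (j : Fin 4) :
    g j ∣ X ^ n - 1 :=
  Ideal.mem_span_singleton.1 (hg j ▸ modulus_mem_leadIdeal hα hJ j)

variable [NeZero n] {D : Submodule (R θ) (Fin n → R θ)}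

theorem leadGenerator_ne_zero {J : Ideal (R θ)[X]} (hα : IsAlpha θ α)
    (hJ : X ^ n - C α ∈ J) (hg : ∀ j, leadIdeal J j = Ideal.span {g j}) (j : Fin 4) :
    g j ≠ 0 := fun h =>
  (monic_X_pow_sub_one n).ne_zero (zero_dvd_iff.1 (h ▸ dvd_modulus hα hJ hg j))

theorem degree_leadGenerator_le {J : Ideal (R θ)[X]} (hα : IsAlpha θ α)
    (hJ : X ^ n - C α ∈ J) (hg : ∀ j, leadIdeal J j = Ideal.span {g j}) (j : Fin 4) :
    (g j).degree ≤ n :=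
  degree_X_pow_sub_one n ▸
    degree_le_of_dvd (dvd_modulus hα hJ hg j) (monic_X_pow_sub_one n).ne_zero

theorem mem_assoc_iff_ofWord_mem (hα : IsAlpha θ α) (hD : IsConstacyclic α D)
    (hg : ∀ j, leadIdeal (codeIdeal α D hD) j = Ideal.span {g j}) (i : Fin 4)
    (a : Fin n → ZMod 2) :
    a ∈ assoc (D : Set (Fin n → R θ)) i ↔ ofWord a ∈ leadIdeal (codeIdeal α D hD) i := by
  have hJ := modulus_mem_codeIdeal hD
  rw [mem_assoc_iff]
  constructor
  · rintro ⟨w, hw, h⟩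
    refine ⟨ofWord w, (ofWord_mem_codeIdeal hD).2 hw, fun j hj => ?_, ?_⟩
    · rw [polyDigit_ofWord]
      simp only [(h _).1 j hj]
      simp [ofWord]
    · rw [polyDigit_ofWord]
      simp only [(h _).2]
  · rintro ⟨f, hf, hf', hfa⟩
    -- Reducing the higher digits makes `f` the polynomial of a word.
    obtain ⟨f', h1, h2, h3⟩ := exists_reduced (leadGenerator_ne_zero hα hJ hg)
      (fun j => hg j ▸ Ideal.mem_span_singleton_self _) i hf
    have hd : f'.degree < n := degree_lt_of_polyDigit fun j => by
      obtain hj | rfl | hj := lt_trichotomy j i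
      · rw [h2 j hj.le, hf' j hj, degree_zero]
        exact WithBot.bot_lt_coe n
      · rw [h2 j le_rfl, hfa]
        exact degree_ofWord_lt a
      · exact (h3 j hj).trans_le (degree_leadGenerator_le hα hJ hg j)
    rw [← ofWord_coeff hd, ofWord_mem_codeIdeal] at h1
    refine ⟨_, h1, fun m => ⟨fun j hj => ?_, ?_⟩⟩
    · rw [← coeff_polyDigit, h2 j hj.le, hf' j hj, coeff_zero]
    · rw [← coeff_polyDigit, h2 i le_rfl, hfa, coeff_ofWord]

/-! ### Normal forms -/

theorem ofWord_word (p : (ZMod 2)[X]) : ofWord (word n p) = p %ₘ (X ^ n - 1) :=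
  ofWord_coeff (degree_mod_modulus_lt n p)

theorem polyDigit_rowWord (t : Fin 4 → Fin 4 → (ZMod 2)[X]) (i j : Fin 4) :
    polyDigit j (ofWord (rowWord θ n t i)) = t i j %ₘ (X ^ n - 1) := by
  rw [polyDigit_ofWord, ← ofWord_word]
  congr 1
  funext m
  exact digit_ofDigits θ (fun j => word n (t i j) m) j

theorem mod_modulus_eq_self {p : (ZMod 2)[X]} (hp : p.degree < n) : p %ₘ (X ^ n - 1) = p :=
  (modByMonic_eq_self_iff (monic_X_pow_sub_one n)).2 (by rwa [degree_X_pow_sub_one])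

/-- In terms of the ideal of the code, a normal form is a triangular array whose rows belong to the
ideal, whose diagonal generates the ideals of leading digits and whose other entries are reduced
modulo the diagonal. -/
theorem isNormalForm_iff (hα : IsAlpha θ α) (hD : IsConstacyclic α D)
    (hg : ∀ j, leadIdeal (codeIdeal α D hD) j = Ideal.span {g j})
    (t : Fin 4 → Fin 4 → (ZMod 2)[X]) :
    IsNormalForm α D t ↔ (∀ i j, j < i → t i j = 0) ∧
      (∀ i, ofWord (rowWord θ n t i) ∈ codeIdeal α D hD) ∧ (∀ i, t i i = g i) ∧
      ∀ i j, i < j → (t i j).degree < (g j).degree := by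
  have hJ := modulus_mem_codeIdeal hD
  have hg0 := leadGenerator_ne_zero hα hJ hg
  have hdiag (i : Fin 4) :
      IsMinimalGenerator n (assoc (D : Set (Fin n → R θ)) i) (t i i) ↔ t i i = g i := by
    rw [isMinimalGenerator_iff (modulus_mem_leadIdeal hα hJ i)
      (mem_assoc_iff_ofWord_mem hα hD hg i), hg i]
    exact ⟨fun h => (eq_of_span_eq h).symm, fun h => by rw [h]⟩
  have hdeg {i j : Fin 4} (hjj : t j j = g j) :
      (t i j = 0 ∨ (t i j).degree < (t j j).degree) ↔ (t i j).degree < (g j).degree := by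
    rw [hjj, or_iff_right_iff_imp]
    intro h
    rw [h, degree_zero, bot_lt_iff_ne_bot]
    exact degree_ne_bot.2 (hg0 j)
  constructor
  · rintro ⟨h1, h2, h3, h4⟩
    have hd := fun i => (hdiag i).1 (h3 i)
    refine ⟨h1, fun i => ?_, hd, fun i j hij => (hdeg (hd j)).1 (h4 i j hij)⟩
    have h : toClass α (rowWord θ n t i) ∈ toClass α '' (D : Set (Fin n → R θ)) := by
      rw [h2]
      exact Ideal.subset_span ⟨i, rfl⟩
    obtain ⟨w, hw, h⟩ := h
    exact ⟨w, hw, h.symm⟩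
  · rintro ⟨h1, h2, h3, h4⟩
    refine ⟨h1, ?_, fun i => (hdiag i).2 (h3 i), fun i j hij => (hdeg (h3 j)).2 (h4 i j hij)⟩
    have hK : codeIdeal α D hD =
        Ideal.span (insert (X ^ n - C α) (Set.range fun i => ofWord (rowWord θ n t i))) := by
      have hle : Ideal.span (insert (X ^ n - C α)
          (Set.range fun i => ofWord (rowWord θ n t i))) ≤ codeIdeal α D hD := by
        rw [Ideal.span_le, Set.insert_subset_iff]
        refine ⟨hJ, ?_⟩
        rintro _ ⟨i, rfl⟩
        exact h2 i
      refine le_antisymm (fun f hf => mem_of_leadIdeal_le hle (fun j => ?_) hf) hle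
      rw [hg j, Ideal.span_singleton_le_iff_mem]
      have hmod := modulus_mem_leadIdeal hα
        (Ideal.subset_span (Set.mem_insert (X ^ n - C α)
          (Set.range fun i => ofWord (rowWord θ n t i)))) j
      have hrow := polyDigit_mem_leadIdeal (i := j) (Ideal.subset_span
        (Set.mem_insert_of_mem (X ^ n - C α) (Set.mem_range_self
          (f := fun i => ofWord (rowWord θ n t i)) j))) fun l hl => by
            rw [polyDigit_rowWord, h1 j l hl, zero_modByMonic]
      rw [polyDigit_rowWord, h3 j, modByMonic_eq_sub_mul_div] at hrow
      -- The row has the leading digit `g j` only up to a multiple of `zⁿ - 1`.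
      convert Ideal.add_mem _ hrow (Ideal.mul_mem_right (g j /ₘ (X ^ n - 1)) _ hmod) using 1
      ring
    rw [image_toClass hD, hK, Ideal.map_span, Set.image_insert_eq, AdjoinRoot.mk_self,
      Ideal.span_insert_zero, ← Set.range_comp]
    rfl

/-! ### The residue conditions -/

theorem map_lift4 (p : (ZMod 2)[X]) :
    (lift4 p).map (ZMod.castHom (by decide) (ZMod 2) : ZMod 4 →+* ZMod 2) = p := by
  have : ∀ x : ZMod 2,
      (ZMod.castHom (by decide) (ZMod 2) : ZMod 4 →+* ZMod 2) (bit (ZMod 4) x) = x := by decide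
  ext m
  rw [coeff_map, coeff_lift4, this]

theorem coeff_two_mul_lift4 (p : (ZMod 2)[X]) (m : ℕ) :
    (2 * lift4 p).coeff m = 2 * bit (ZMod 4) (p.coeff m) := by
  have h2 : (2 : (ZMod 4)[X]) = C 2 := rfl
  rw [h2, coeff_C_mul, coeff_lift4]

theorem exists_eq_two_mul_lift4 {E : (ZMod 4)[X]}
    (hE : E.map (ZMod.castHom (by decide) (ZMod 2) : ZMod 4 →+* ZMod 2) = 0) :
    ∃ w, E = 2 * lift4 w := by
  have key : ∀ x : ZMod 4, (ZMod.castHom (by decide) (ZMod 2) : ZMod 4 →+* ZMod 2) x = 0 →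
      x = 2 * bit (ZMod 4) ((x.val / 2 : ℕ) : ZMod 2) := by decide
  refine ⟨coeffMap (fun x : ZMod 4 => ((x.val / 2 : ℕ) : ZMod 2)) E, ?_⟩
  ext1 m
  rw [coeff_two_mul_lift4, coeff_coeffMap (by decide)]
  refine key _ ?_
  rw [← coeff_map, hE, coeff_zero]

theorem two_mul_lift4_mul (p q : (ZMod 2)[X]) :
    2 * lift4 (p * q) = 2 * lift4 p * lift4 q := by
  obtain ⟨w, hw⟩ := exists_eq_two_mul_lift4 (E := lift4 (p * q) - lift4 p * lift4 q) (by
    rw [Polynomial.map_sub, Polynomial.map_mul, map_lift4, map_lift4, map_lift4, sub_self])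
  have h4 : (2 * 2 : (ZMod 4)[X]) = 0 := by
    have : (C (2 * 2 : ZMod 4) : (ZMod 4)[X]) = 0 := by
      rw [show (2 * 2 : ZMod 4) = 0 from by decide, C_0]
    rwa [C_mul] at this
  linear_combination 2 * hw + lift4 w * h4

/-- For `h q = zⁿ - 1`, the polynomial `h (q + 2 p) - (zⁿ - ε)` over `Z₄` vanishes modulo `2`; the
residue condition says that its half `w` is divisible by `a`. -/
theorem residueCondition_of_mem {ε : ZMod 4}
    (hε : (ZMod.castHom (by decide) (ZMod 2) : ZMod 4 →+* ZMod 2) ε = 1) {q p a : (ZMod 2)[X]}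
    (hq : q ∣ X ^ n - 1) (hpa : p.degree < a.degree)
    (H : ∀ w, lift4 ((X ^ n - 1) / q) * (lift4 q + 2 * lift4 p) - (X ^ n - C ε) = 2 * lift4 w →
      a ∣ w) : ResidueCondition n ε q p a := by
  have h2 : (2 : (ZMod 2)[X]) = 0 := by
    have : (C (2 : ZMod 2) : (ZMod 2)[X]) = 0 := by
      rw [show (2 : ZMod 2) = 0 from by decide, C_0]
    exact this
  obtain ⟨w, hw⟩ := exists_eq_two_mul_lift4
    (E := lift4 ((X ^ n - 1) / q) * (lift4 q + 2 * lift4 p) - (X ^ n - C ε)) (by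
      simp only [Polynomial.map_sub, Polynomial.map_mul, Polynomial.map_add, map_lift4,
        Polynomial.map_pow, map_X, map_C, hε, C_1, Polynomial.map_ofNat]
      rw [h2, zero_mul, add_zero, mul_comm, EuclideanDomain.mul_div_cancel' ?_ hq, sub_self]
      rintro rfl
      exact (monic_X_pow_sub_one n).ne_zero (zero_dvd_iff.1 hq))
  obtain ⟨c, rfl⟩ := H w hw
  exact Or.inr ⟨⟨lift4 c, by rw [hw, two_mul_lift4_mul]⟩, hpa⟩

theorem residueHom_eq (θ : Theta) (x : R θ) :
    residueHom θ x = bit (ZMod 4) (digit θ 0 x) + 2 * bit (ZMod 4) (digit θ 1 x) := by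
  obtain ⟨a, b⟩ := x
  cases θ <;> revert a b <;> decide

theorem residueHom_bit (θ : Theta) (x : ZMod 2) : residueHom θ (bit (R θ) x) = bit (ZMod 4) x := by
  cases θ <;> revert x <;> decide

theorem digit_of_residueHom_eq (θ : Theta) (x : R θ) (y : ZMod 2)
    (h : residueHom θ x = 2 * bit (ZMod 4) y) :
    (∀ j < 1, digit θ j x = 0) ∧ digit θ 1 x = y := by
  obtain ⟨a, b⟩ := x
  cases θ <;> revert a b y <;> decide

theorem digit_two_mul (θ : Theta) (i : Fin 4) (hi : i = 0 ∨ i = 2) (x : R θ)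
    (h : ∀ j < i, digit θ j x = 0) :
    (∀ j < i + 1, digit θ j (2 * x) = 0) ∧ digit θ (i + 1) (2 * x) = digit θ i x := by
  obtain ⟨a, b⟩ := x
  cases θ <;> revert i a b <;> decide

/-- Multiplication by `2` carries the digits `0` and `2` to the digits `1` and `3`. -/
theorem leadIdeal_le_succ (J : Ideal (R θ)[X]) {i : Fin 4} (hi : i = 0 ∨ i = 2) :
    leadIdeal J i ≤ leadIdeal J (i + 1) := by
  rintro _ ⟨f, hf, hf', rfl⟩
  have h2 : (2 : (R θ)[X]) = C 2 := rfl
  refine ⟨2 * f, J.mul_mem_left _ hf, fun j hj => ?_, ?_⟩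
  · ext m
    rw [coeff_polyDigit, h2, coeff_C_mul, (digit_two_mul θ i hi _ (hf'.coeff m)).1 j hj, coeff_zero]
  · ext m
    rw [coeff_polyDigit, h2, coeff_C_mul, (digit_two_mul θ i hi _ (hf'.coeff m)).2, coeff_polyDigit]

/-- If the leading digit `g i` is `zⁿ - 1`, which reduces to zero, then the next digit is a leading
one and vanishes, being of small degree. -/
theorem polyDigit_eq_of_succ_ne_zero {J : Ideal (R θ)[X]}
    (hg : ∀ j, leadIdeal J j = Ideal.span {g j}) {i : Fin 4} (hi : i = 0 ∨ i = 2)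
    {f : (R θ)[X]} (hf : f ∈ J) (hA : Above i f) (hfi : polyDigit i f = g i %ₘ (X ^ n - 1))
    (hd : (polyDigit (i + 1) f).degree < (g (i + 1)).degree) (hne : polyDigit (i + 1) f ≠ 0) :
    polyDigit i f = g i := by
  obtain hlt | hge := lt_or_ge (g i).degree (n : WithBot ℕ)
  · rw [hfi, mod_modulus_eq_self hlt]
  · refine absurd ?_ hne
    have h0 : polyDigit i f = 0 := eq_zero_of_mem_of_degree_lt (hg i)
      (polyDigit_mem_leadIdeal hf hA) (hfi ▸ (degree_mod_modulus_lt n _).trans_le hge)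
    refine eq_zero_of_mem_of_degree_lt (hg (i + 1)) (polyDigit_mem_leadIdeal hf fun j hj => ?_) hd
    obtain rfl | hj := eq_or_lt_of_le (show j ≤ i by
      rcases hi with rfl | rfl <;> revert j <;> decide)
    · exact h0
    · exact hA j hj

/-- Up to elements of `k_θ R_θ`, the multiple of the row `f` with vanishing `0`-th digit is the
difference in the residue condition. -/
theorem residueCondition_zero {J : Ideal (R θ)[X]} (hα : IsAlpha θ α) (hJ : X ^ n - C α ∈ J)
    (hg : ∀ j, leadIdeal J j = Ideal.span {g j}) {f : (R θ)[X]} (hf : f ∈ J)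
    (hf0 : polyDigit 0 f = g 0) (hd : (polyDigit 1 f).degree < (g 1).degree) :
    ResidueCondition n 1 (g 0) (polyDigit 1 f) (g 1) := by
  refine residueCondition_of_mem (map_one _) (dvd_modulus hα hJ hg 0) hd fun w hw => ?_
  set h := (X ^ n - 1) / g 0
  have hfm : f.map (residueHom θ) = lift4 (g 0) + 2 * lift4 (polyDigit 1 f) := by
    ext1 m
    rw [coeff_map, residueHom_eq, coeff_add, coeff_lift4, coeff_two_mul_lift4, ← hf0,
      coeff_polyDigit, coeff_polyDigit]
  have hhm : (liftR θ h).map (residueHom θ) = lift4 h := by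
    ext1 m
    rw [coeff_map, coeff_liftR, residueHom_bit, coeff_lift4]
  have hF : (liftR θ h * f - (X ^ n - C α)).map (residueHom θ) = 2 * lift4 w := by
    rw [← hw, Polynomial.map_sub, Polynomial.map_mul, hfm, hhm, Polynomial.map_sub,
      Polynomial.map_pow, map_X, map_C, residueHom_alpha θ α hα]
  have hc (m : ℕ) := digit_of_residueHom_eq θ _ (w.coeff m) (by
    rw [← coeff_map, hF, coeff_two_mul_lift4])
  rw [← Ideal.mem_span_singleton, ← hg 1]
  refine ⟨_, J.sub_mem (J.mul_mem_left (liftR θ h) hf) hJ, fun j hj => ?_, ?_⟩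
  · ext m
    rw [coeff_polyDigit, (hc m).1 j hj, coeff_zero]
  · ext m
    rw [coeff_polyDigit, (hc m).2]

/-- Here the row is `k_θ` times a polynomial over `Z₄`, and `k_θ α = ε k_θ` turns `zⁿ - α` into
`zⁿ - ε`. -/
theorem residueCondition_two {J : Ideal (R θ)[X]} (hα : IsAlpha θ α) (hJ : X ^ n - C α ∈ J)
    (hg : ∀ j, leadIdeal J j = Ideal.span {g j}) {f : (R θ)[X]} (hf : f ∈ J) (hA : Above 2 f)
    (hf2 : polyDigit 2 f = g 2) (hd : (polyDigit 3 f).degree < (g 3).degree) :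
    ResidueCondition n (epsilon θ α) (g 2) (polyDigit 3 f) (g 3) := by
  refine residueCondition_of_mem (epsilon_alpha θ α hα) (dvd_modulus hα hJ hg 2) hd fun w hw => ?_
  set h := (X ^ n - 1) / g 2
  have hfm : C (k θ) * (lift4 (g 2) + 2 * lift4 (polyDigit 3 f)).map (algebraMap (ZMod 4) (R θ))
      = f := by
    ext1 m
    rw [coeff_C_mul, coeff_map, coeff_add, coeff_lift4, coeff_two_mul_lift4, ← hf2,
      coeff_polyDigit, coeff_polyDigit, eq_k_mul θ _ (hA.coeff m)]
  have hhm : (lift4 h).map (algebraMap (ZMod 4) (R θ)) = liftR θ h := by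
    ext1 m
    rw [coeff_map, coeff_liftR, coeff_lift4, bit, bit, map_natCast]
  have hF : liftR θ h * f - (X ^ n - C α) * C (k θ) =
      C (k θ) * (2 * lift4 w).map (algebraMap (ZMod 4) (R θ)) := by
    have hk : C (k θ) * C α = C (algebraMap (ZMod 4) (R θ) (epsilon θ α)) * C (k θ) := by
      rw [← C_mul, ← C_mul, k_mul]
    rw [← hw, Polynomial.map_sub, Polynomial.map_mul, hhm, Polynomial.map_sub,
      Polynomial.map_pow, map_X, map_C]
    linear_combination -liftR θ h * hfm + hk
  have hc (m : ℕ) : (liftR θ h * f - (X ^ n - C α) * C (k θ)).coeff m =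
      k θ * algebraMap (ZMod 4) (R θ) (2 * bit (ZMod 4) (w.coeff m)) := by
    rw [hF, coeff_C_mul, coeff_map, coeff_two_mul_lift4]
  rw [← Ideal.mem_span_singleton, ← hg 3]
  refine ⟨_, J.sub_mem (J.mul_mem_left (liftR θ h) hf) (J.mul_mem_right (C (k θ)) hJ),
    fun j hj => ?_, ?_⟩
  · ext m
    rw [coeff_polyDigit, hc m, (digit_k_mul_two_mul θ _).1 j hj, coeff_zero]
  · ext m
    rw [coeff_polyDigit, hc m, (digit_k_mul_two_mul θ _).2]

end Constacyclic

theorem mainTheorem2 (θ : Constacyclic.Theta) (n : ℕ) [NeZero n] (α : Constacyclic.R θ)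
    (hα : Constacyclic.IsAlpha θ α)
    (D : Submodule (Constacyclic.R θ) (Fin n → Constacyclic.R θ))
    (hD : Constacyclic.IsConstacyclic α D) :
    ∃ t : Fin 4 → Fin 4 → (ZMod 2)[X],
      Constacyclic.IsNormalForm α D t ∧
      (t 1 1 ∣ t 0 0 ∧ t 0 0 ∣ X ^ n - 1) ∧
      Constacyclic.ResidueCondition n 1 (t 0 0) (t 0 1) (t 1 1) ∧
      (t 3 3 ∣ t 2 2 ∧ t 2 2 ∣ X ^ n - 1) ∧
      Constacyclic.ResidueCondition n (Constacyclic.epsilon θ α) (t 2 2) (t 2 3) (t 3 3) ∧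
      ∀ t' : Fin 4 → Fin 4 → (ZMod 2)[X], Constacyclic.IsNormalForm α D t' → t' = t := by
  open Constacyclic in
  set J := codeIdeal α D hD
  have hJ : X ^ n - C α ∈ J := modulus_mem_codeIdeal hD
  have hex (j : Fin 4) : ∃ g, leadIdeal J j = Ideal.span {g} :=
    (IsPrincipalIdealRing.principal (leadIdeal J j)).principal
  choose g hg using hex
  have hg0 := leadGenerator_ne_zero hα hJ hg
  have hgn := degree_leadGenerator_le hα hJ hg
  have hgm (j : Fin 4) : g j ∈ leadIdeal J j := hg j ▸ Ideal.mem_span_singleton_self _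
  have hrow (i : Fin 4) : ∃ f ∈ J, Above i f ∧ polyDigit i f = g i %ₘ (X ^ n - 1) ∧
      ∀ j, i < j → (polyDigit j f).degree < (g j).degree := by
    obtain ⟨f, hf, hf', hfi⟩ := mod_modulus_mem (modulus_mem_leadIdeal hα hJ i) (hgm i)
    obtain ⟨f', h1, h2, h3⟩ := exists_reduced hg0 hgm i hf
    exact ⟨f', h1, fun j hj => by rw [h2 j hj.le, hf' j hj], by rw [h2 i le_rfl, hfi], h3⟩
  choose f hf hA hfi hfd using hrow
  have hdvd {i : Fin 4} (hi : i = 0 ∨ i = 2) : g (i + 1) ∣ g i :=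
    Ideal.mem_span_singleton.1 (hg (i + 1) ▸ leadIdeal_le_succ J hi (hgm i))
  -- The diagonal entry is `g i` and not the `i`-th digit of `f i`: they differ if `g i = zⁿ - 1`.
  let t : Fin 4 → Fin 4 → (ZMod 2)[X] := fun i j => if j = i then g i else polyDigit j (f i)
  have htd (i : Fin 4) : t i i = g i := if_pos rfl
  have hto {i j : Fin 4} (h : j ≠ i) : t i j = polyDigit j (f i) := if_neg h
  have hrowf (i : Fin 4) : ofWord (rowWord θ n t i) = f i := eq_of_polyDigit_eq fun j => by
    rw [polyDigit_rowWord]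
    obtain hj | rfl | hj := lt_trichotomy j i
    · rw [hto hj.ne, hA i j hj, zero_modByMonic]
    · rw [htd, hfi]
    · rw [hto hj.ne', mod_modulus_eq_self ((hfd i j hj).trans_le (hgn j))]
  have ht : IsNormalForm α D t := (isNormalForm_iff hα hD hg t).2
    ⟨fun i j hj => by rw [hto hj.ne, hA i j hj], fun i => hrowf i ▸ hf i, htd,
      fun i j hij => hto hij.ne' ▸ hfd i j hij⟩
  refine ⟨t, ht, ?_, ?_, ?_, ?_, fun t' ht' => ?_⟩
  · rw [htd, htd]
    exact ⟨hdvd (i := 0) (Or.inl rfl), dvd_modulus hα hJ hg 0⟩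
  · rw [htd, htd, hto (by decide)]
    by_cases h0 : polyDigit 1 (f 0) = 0
    · exact Or.inl h0
    · have hd := hfd 0 1 (by decide)
      exact residueCondition_zero hα hJ hg (hf 0)
        (polyDigit_eq_of_succ_ne_zero hg (Or.inl rfl) (hf 0) (hA 0) (hfi 0) hd h0) hd
  · rw [htd, htd]
    exact ⟨hdvd (i := 2) (Or.inr rfl), dvd_modulus hα hJ hg 2⟩
  · rw [htd, htd, hto (by decide)]
    by_cases h0 : polyDigit 3 (f 2) = 0
    · exact Or.inl h0
    · have hd := hfd 2 3 (by decide)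
      exact residueCondition_two hα hJ hg (hf 2) (hA 2)
        (polyDigit_eq_of_succ_ne_zero hg (Or.inr rfl) (hf 2) (hA 2) (hfi 2) hd h0) hd
  · obtain ⟨h1, h2, h3, h4⟩ := (isNormalForm_iff hα hD hg t').1 ht'
    have hmod {i j : Fin 4} (hij : i < j) :
        polyDigit j (ofWord (rowWord θ n t' i)) = t' i j := by
      rw [polyDigit_rowWord, mod_modulus_eq_self ((h4 i j hij).trans_le (hgn j))]
    have heq (i : Fin 4) : ofWord (rowWord θ n t' i) = f i := by
      refine eq_of_reduced hg (i := i) (h2 i) (hf i) (fun l hl => ?_)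
        (fun j hj => hmod hj ▸ h4 i j hj) (hfd i)
      obtain hl | rfl := hl.lt_or_eq
      · rw [polyDigit_rowWord, h1 i l hl, zero_modByMonic, hA i l hl]
      · rw [polyDigit_rowWord, h3, hfi]
    funext i j
    obtain hj | rfl | hj := lt_trichotomy j i
    · rw [h1 i j hj, hto hj.ne, hA i j hj]
    · rw [h3, htd]
    · rw [← hmod hj, heq, hto hj.ne']
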